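/- Let $X$ be an $L^\infty$-matricial Riesz normed space: a complex vector space with a conjugate-linear involution $*$ (so that $[x_{ij}]^*=[x_{ji}^*]$ on $M_n(X)$), together with, for every $n$, a cone $M_n(X)_+$ of selfadjoint elements of $M_n(X)$ and a norm on $M_n(X)$, such that $\gamma^*M_m(X)_+\gamma\subseteq M_n(X)_+$ for all scalar $m\times n$ matrices $\gamma$; $\|\alpha v\beta\|\le\|\alpha\|\|v\|\|\beta\|$ for scalar matrices $\alpha,\beta$ and $\|v\oplus w\|=\max\{\|v\|,\|w\|\}$; each $M_n(X)_+$ is norm closed; and for all $v\in M_n(X)$ $$\|v\|=\inf\Big\{\max\{\|u_1\|,\|u_2\|\} : u_1,u_2\in M_n(X)_+,\ \begin{bmatrix}u_1&v\\ v^*&u_2\end{bmatrix}\in M_{2n}(X)_+\Big\}.$$ On the $*$-vector space $X\oplus\mathbb C$ with unit $1=(0,1)$ write elements of $M_n(X\oplus\mathbb C)$ as pairs $(v,A)$ with $v\in M_n(X)$, $A\in M_n(\mathbb C)$. Werner's unitization $X^+$ is $X\oplus\mathbb C$ with the cones in which a selfadjoint $(v,A)$ is positive iff $A\ge0$ and $\varphi\big((A+\epsilon)^{-1/2}v(A+\epsilon)^{-1/2}\big)\ge-1$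 for all $\epsilon>0$ and all positive contractive linear functionals $\varphi$ on $M_n(X)$. Karn's unitization $\tilde X$ is $X\oplus\mathbb C$ with the cones in which a selfadjoint $(v,A)$ is positive iff $A\ge0$ and for every $\epsilon>0$ there is $u\in M_n(X)_+$ with $\|u\|<1$ and $v+(A+\epsilon)^{1/2}u(A+\epsilon)^{1/2}\in M_n(X)_+$. Then $X^+$ and $\tilde X$ are operator systems with unit $1$ (matrix ordered $*$-vector spaces with proper cones for which $1$ is an Archimedean matrix order unit), and $X^+=\tilde X$: the identity map $X^+\to\tilde X$ is a complete order isomorphism and a complete isometry, where both carry the operator system norms $\|w\|=\inf\big\{t\ge0:\begin{bmatrix}t1_n&w\\ w^*&t1_n\end{bmatrix}\ge0\big\}$, $w\in M_n(X\oplus\mathbb C)$. -/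

import Mathlib

open scoped Matrix

section MatrixSpaces

variable {V W : Type*} [AddCommGroup V] [Module ℂ V] [AddCommGroup W] [Module ℂ W]

/-- The product `α v β` of a matrix `v` over a complex vector space with scalar matrices. -/
def scalarSandwich {m n p q : ℕ} (α : Matrix (Fin m) (Fin n) ℂ) (v : Matrix (Fin n) (Fin p) V)
    (β : Matrix (Fin p) (Fin q) ℂ) : Matrix (Fin m) (Fin q) V :=
  Matrix.of fun i j => ∑ k, ∑ l, (α i k * β l j) • v k l

/-- The block matrix `[[a, b], [c, d]]`, indexed by `Fin (m + n)`. -/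
def blockMatrix {m n : ℕ} (a : Matrix (Fin m) (Fin m) V) (b : Matrix (Fin m) (Fin n) V)
    (c : Matrix (Fin n) (Fin m) V) (d : Matrix (Fin n) (Fin n) V) :
    Matrix (Fin (m + n)) (Fin (m + n)) V :=
  Matrix.reindex finSumFinEquiv finSumFinEquiv (Matrix.fromBlocks a b c d)

/-- A family of subsets of `M_n(V)`, `n ∈ ℕ` (the candidates for the positive cones). -/
abbrev MatrixCones (V : Type*) := ∀ n : ℕ, Set (Matrix (Fin n) (Fin n) V)

/-- A family of real-valued functions on `M_n(V)`, `n ∈ ℕ` (the candidates for the norms). -/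
abbrev MatrixNorms (V : Type*) := ∀ n : ℕ, Matrix (Fin n) (Fin n) V → ℝ

/-- A matrix order on a `*`-vector space: cones of selfadjoint matrices with
`γ* M_m(V)₊ γ ⊆ M_n(V)₊`. Closure under multiplication by `t ≥ 0` is the case `γ = √t • 1`. -/
structure IsMatrixOrder [Star V] (C : MatrixCones V) : Prop where
  nonempty : ∀ n, (C n).Nonempty
  isHermitian : ∀ n, ∀ v ∈ C n, v.IsHermitian
  add_mem : ∀ n, ∀ v ∈ C n, ∀ w ∈ C n, v + w ∈ C n
  compress_mem : ∀ (m n : ℕ) (γ : Matrix (Fin m) (Fin n) ℂ), ∀ v ∈ C m,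
    scalarSandwich γᴴ v γ ∈ C n

open scoped Matrix.Norms.L2Operator in
/-- An `L^∞`-matrix norm (an abstract operator space structure, completeness not required):
norms on all `M_n(V)` with `‖α v β‖ ≤ ‖α‖ ‖v‖ ‖β‖` (operator norms of the scalar matrices) and
`‖v ⊕ w‖ = max ‖v‖ ‖w‖`. -/
structure IsLInftyMatrixNorm (N : MatrixNorms V) : Prop where
  add_le : ∀ n v w, N n (v + w) ≤ N n v + N n w
  smul_eq : ∀ n (c : ℂ) v, N n (c • v) = ‖c‖ * N n v
  eq_zero : ∀ n v, N n v = 0 → v = 0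
  sandwich_le : ∀ (m n : ℕ) (α : Matrix (Fin m) (Fin n) ℂ) (v : Matrix (Fin n) (Fin n) V)
    (β : Matrix (Fin n) (Fin m) ℂ), N m (scalarSandwich α v β) ≤ ‖α‖ * N n v * ‖β‖
  directSum_eq : ∀ (m n : ℕ) (v : Matrix (Fin m) (Fin m) V) (w : Matrix (Fin n) (Fin n) V),
    N (m + n) (blockMatrix v 0 0 w) = max (N m v) (N n w)

/-- An `L^∞`-matricial Riesz normed space: a `*`-vector space with a matrix order and an
`L^∞`-matrix norm such that the cones are norm closed and
`‖v‖ = inf {max ‖u₁‖ ‖u₂‖ : u₁, u₂ ≥ 0, [[u₁, v], [v*, u₂]] ≥ 0}` for `v ∈ M_n(V)`. -/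
structure IsLInftyMatricialRieszNormed [Star V] (C : MatrixCones V) (N : MatrixNorms V) :
    Prop where
  matrixOrder : IsMatrixOrder C
  matrixNorm : IsLInftyMatrixNorm N
  closed : ∀ n v, (∀ ε > 0, ∃ c ∈ C n, N n (v - c) < ε) → v ∈ C n
  riesz : ∀ n (v : Matrix (Fin n) (Fin n) V),
    IsGLB {r : ℝ | ∃ u₁ ∈ C n, ∃ u₂ ∈ C n,
      blockMatrix u₁ v vᴴ u₂ ∈ C (n + n) ∧ r = max (N n u₁) (N n u₂)} (N n v)

/-- The matrix `t e_n` in `M_n(V)`: `t • e` on the diagonal and zero elsewhere. -/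
def unitMatrix (e : V) (n : ℕ) (t : ℝ) : Matrix (Fin n) (Fin n) V :=
  Matrix.diagonal fun _ => (t : ℂ) • e

/-- An (abstract, unital) operator system: a matrix ordered `*`-vector space with proper cones
and an Archimedean matrix order unit `e`. -/
structure IsOperatorSystem [Star V] (C : MatrixCones V) (e : V) : Prop where
  matrixOrder : IsMatrixOrder C
  proper : ∀ n, ∀ v ∈ C n, -v ∈ C n → v = 0
  orderUnit : ∀ n (v : Matrix (Fin n) (Fin n) V), v.IsHermitian →
    ∃ t > 0, unitMatrix e n t + v ∈ C n
  archimedean : ∀ n (v : Matrix (Fin n) (Fin n) V),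
    (∀ t > 0, unitMatrix e n t + v ∈ C n) → v ∈ C n

/-- The matrix norms of an operator system:
`‖v‖ = inf {t ≥ 0 : [[t e_n, v], [v*, t e_n]] ≥ 0}`. -/
noncomputable def operatorSystemNorm [Star V] (C : MatrixCones V) (e : V) : MatrixNorms V :=
  fun n v => sInf {t : ℝ | 0 ≤ t ∧
    blockMatrix (unitMatrix e n t) v vᴴ (unitMatrix e n t) ∈ C (n + n)}

/-- `T` is a complete order isomorphism: each amplification maps cone onto cone. -/
def IsCompleteOrderIso (C : MatrixCones V) (D : MatrixCones W) (T : V ≃ₗ[ℂ] W) : Prop :=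
  ∀ n (v : Matrix (Fin n) (Fin n) V), v.map T ∈ D n ↔ v ∈ C n

/-- `T` is a complete isometry: each amplification is isometric. -/
def IsCompleteIsometry (N : MatrixNorms V) (M : MatrixNorms W) (T : V ≃ₗ[ℂ] W) : Prop :=
  ∀ n (v : Matrix (Fin n) (Fin n) V), M n (v.map T) = N n v

end MatrixSpaces

section Unitizations

variable {X : Type*} [AddCommGroup X] [Module ℂ X] [StarAddMonoid X]

open scoped MatrixOrder in
/-- `(A + ε)^{1/2}` for a scalar matrix `A`. -/
noncomputable def shiftedSqrt {n : ℕ} (A : Matrix (Fin n) (Fin n) ℂ) (ε : ℝ) :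
    Matrix (Fin n) (Fin n) ℂ :=
  CFC.sqrt (A + (ε : ℂ) • (1 : Matrix (Fin n) (Fin n) ℂ))

open scoped ComplexOrder in
/-- A positive contractive linear functional on `M_n(X)`. -/
def IsPositiveContractive (C : MatrixCones X) (N : MatrixNorms X) {n : ℕ}
    (φ : Matrix (Fin n) (Fin n) X →ₗ[ℂ] ℂ) : Prop :=
  (∀ c ∈ C n, 0 ≤ φ c) ∧ ∀ v, ‖φ v‖ ≤ N n v

open scoped ComplexOrder in
/-- The cones of Werner's unitization of `X` on `X ⊕ ℂ`. A matrix over `X ⊕ ℂ` is identified with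
the pair `(v, A)`, `v ∈ M_n(X)`, `A ∈ M_n`, of its components; a selfadjoint one is positive iff
`A ≥ 0` and `φ((A + ε)^{-1/2} v (A + ε)^{-1/2}) ≥ -1` for all `ε > 0` and all positive contractive
functionals `φ` on `M_n(X)`. -/
def wernerCones (C : MatrixCones X) (N : MatrixNorms X) : MatrixCones (X × ℂ) :=
  fun n => {w | w.IsHermitian ∧ (w.map Prod.snd).PosSemidef ∧
    ∀ ε : ℝ, 0 < ε → ∀ φ : Matrix (Fin n) (Fin n) X →ₗ[ℂ] ℂ, IsPositiveContractive C N φ →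
      -1 ≤ (φ (scalarSandwich (shiftedSqrt (w.map Prod.snd) ε)⁻¹ (w.map Prod.fst)
        (shiftedSqrt (w.map Prod.snd) ε)⁻¹)).re}

open scoped ComplexOrder in
/-- The cones of Karn's unitization of `X` on `X ⊕ ℂ`: a selfadjoint `(v, A)` is positive iff
`A ≥ 0` and for every `ε > 0` there is `u ∈ M_n(X)₊` with `‖u‖ < 1` and
`v + (A + ε)^{1/2} u (A + ε)^{1/2} ≥ 0`. -/
def karnCones (C : MatrixCones X) (N : MatrixNorms X) : MatrixCones (X × ℂ) :=
  fun n => {w | w.IsHermitian ∧ (w.map Prod.snd).PosSemidef ∧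
    ∀ ε : ℝ, 0 < ε → ∃ u ∈ C n, N n u < 1 ∧
      w.map Prod.fst + scalarSandwich (shiftedSqrt (w.map Prod.snd) ε) u
        (shiftedSqrt (w.map Prod.snd) ε) ∈ C n}

end Unitizations

/-! Everything follows once the two families of cones are shown to coincide; only Karn's cones are
then checked to form an operator system.

Write `S = (A + ε)^{1/2}` and `x = S⁻¹ v S⁻¹`. Compressing by `S⁻¹` turns Karn's condition into:
some `u ≥ 0` with `‖u‖ < 1` satisfies `x + u ≥ 0`. Hence `φ(x) ≥ -φ(u) ≥ -1` for every positive
contractive `φ`, so Karn positivity gives Werner positivity. The converse is Hahn-Banach: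
`dominatingGauge`, the infimum of `‖u‖` over `u ≥ 0` dominating `Re y`, is sublinear and, by the
Riesz formula, at most the norm. A real functional below it complexifies to a positive contractive
one, so the gauge is attained by such functionals (`exists_functional_eq_dominatingGauge`). Werner's
condition then gives `-x` gauge at most `1`, and the excess over `1` is absorbed by working at `ε /
4`.

The operator system axioms rest on `mem_karnCones_iff`: `S u S` may be replaced by `β* u β` with any
rectangular `β` such that `β* β ≤ A + ε`. Sums then correspond to stacking the `β`s, and compression
by `γ` to passing from `β` to `β γ`. -/

/-! ### Block matrices. -/

section Block

variable {V : Type*} {m n : ℕ}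

section Apply

variable (a : Matrix (Fin m) (Fin m) V) (b : Matrix (Fin m) (Fin n) V)
  (c : Matrix (Fin n) (Fin m) V) (d : Matrix (Fin n) (Fin n) V)

@[simp] lemma blockMatrix_castAdd_castAdd (i j : Fin m) :
    blockMatrix a b c d (Fin.castAdd n i) (Fin.castAdd n j) = a i j := by
  simp [blockMatrix]

@[simp] lemma blockMatrix_castAdd_natAdd (i : Fin m) (j : Fin n) :
    blockMatrix a b c d (Fin.castAdd n i) (Fin.natAdd m j) = b i j := by
  simp [blockMatrix]

@[simp] lemma blockMatrix_natAdd_castAdd (i : Fin n) (j : Fin m) :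
    blockMatrix a b c d (Fin.natAdd m i) (Fin.castAdd n j) = c i j := by
  simp [blockMatrix]

@[simp] lemma blockMatrix_natAdd_natAdd (i j : Fin n) :
    blockMatrix a b c d (Fin.natAdd m i) (Fin.natAdd m j) = d i j := by
  simp [blockMatrix]

end Apply

lemma blockMatrix_add [AddCommGroup V] (a a' : Matrix (Fin m) (Fin m) V) (b b' : Matrix (Fin m) (Fin n) V)
    (c c' : Matrix (Fin n) (Fin m) V) (d d' : Matrix (Fin n) (Fin n) V) :
    blockMatrix a b c d + blockMatrix a' b' c' d' =
      blockMatrix (a + a') (b + b') (c + c') (d + d') := by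
  ext i j
  refine Fin.addCases (fun i => ?_) (fun i => ?_) i <;>
  refine Fin.addCases (fun j => ?_) (fun j => ?_) j <;>
  simp

end Block

/-! ### Algebra of scalar compressions. -/

section SandwichAlgebra

variable {V : Type*} [AddCommGroup V] [Module ℂ V]

/-- The vertical concatenation of two scalar matrices. -/
def vstack {m p n : ℕ} (α : Matrix (Fin m) (Fin n) ℂ) (β : Matrix (Fin p) (Fin n) ℂ) :
    Matrix (Fin (m + p)) (Fin n) ℂ :=
  Matrix.reindex finSumFinEquiv (Equiv.refl _) (Matrix.fromRows α β)

/-- The horizontal concatenation of two scalar matrices. -/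
def hstack {m n p : ℕ} (α : Matrix (Fin m) (Fin n) ℂ) (β : Matrix (Fin m) (Fin p) ℂ) :
    Matrix (Fin m) (Fin (n + p)) ℂ :=
  Matrix.reindex (Equiv.refl _) finSumFinEquiv (Matrix.fromCols α β)

@[simp] lemma vstack_castAdd {m p n : ℕ} (α : Matrix (Fin m) (Fin n) ℂ)
    (β : Matrix (Fin p) (Fin n) ℂ) (i : Fin m) (j : Fin n) :
    vstack α β (Fin.castAdd p i) j = α i j := by
  simp [vstack]

@[simp] lemma vstack_natAdd {m p n : ℕ} (α : Matrix (Fin m) (Fin n) ℂ)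
    (β : Matrix (Fin p) (Fin n) ℂ) (i : Fin p) (j : Fin n) :
    vstack α β (Fin.natAdd m i) j = β i j := by
  simp [vstack]

@[simp] lemma hstack_castAdd {m n p : ℕ} (α : Matrix (Fin m) (Fin n) ℂ)
    (β : Matrix (Fin m) (Fin p) ℂ) (i : Fin m) (j : Fin n) :
    hstack α β i (Fin.castAdd p j) = α i j := by
  simp [hstack]

@[simp] lemma hstack_natAdd {m n p : ℕ} (α : Matrix (Fin m) (Fin n) ℂ)
    (β : Matrix (Fin m) (Fin p) ℂ) (i : Fin m) (j : Fin p) :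
    hstack α β i (Fin.natAdd n j) = β i j := by
  simp [hstack]

lemma conjTranspose_vstack_mul_vstack {m p n : ℕ} (α : Matrix (Fin m) (Fin n) ℂ)
    (β : Matrix (Fin p) (Fin n) ℂ) :
    (vstack α β)ᴴ * vstack α β = αᴴ * α + βᴴ * β := by
  ext i j
  simp [Matrix.mul_apply, Fin.sum_univ_add]

lemma scalarSandwich_vstack {m p n : ℕ} (α : Matrix (Fin m) (Fin n) ℂ)
    (β : Matrix (Fin p) (Fin n) ℂ) (a : Matrix (Fin m) (Fin m) V) (b : Matrix (Fin m) (Fin p) V)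
    (c : Matrix (Fin p) (Fin m) V) (d : Matrix (Fin p) (Fin p) V) :
    scalarSandwich (vstack α β)ᴴ (blockMatrix a b c d) (vstack α β) =
      scalarSandwich αᴴ a α + scalarSandwich αᴴ b β + scalarSandwich βᴴ c α +
        scalarSandwich βᴴ d β := by
  ext i j
  simp [scalarSandwich, Fin.sum_univ_add, Finset.sum_add_distrib]
  abel

lemma scalarSandwich_hstack {m n p : ℕ} (α : Matrix (Fin m) (Fin n) ℂ)
    (β : Matrix (Fin m) (Fin p) ℂ) (v : Matrix (Fin m) (Fin m) V) :
    scalarSandwich (hstack α β)ᴴ v (hstack α β) =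
      blockMatrix (scalarSandwich αᴴ v α) (scalarSandwich αᴴ v β) (scalarSandwich βᴴ v α)
        (scalarSandwich βᴴ v β) := by
  ext i j
  refine Fin.addCases (fun i => ?_) (fun i => ?_) i <;>
  refine Fin.addCases (fun j => ?_) (fun j => ?_) j <;>
  simp [scalarSandwich]

variable {m n p q r s : ℕ}

lemma scalarSandwich_add (α : Matrix (Fin m) (Fin n) ℂ) (v w : Matrix (Fin n) (Fin p) V)
    (β : Matrix (Fin p) (Fin q) ℂ) :
    scalarSandwich α (v + w) β = scalarSandwich α v β + scalarSandwich α w β := by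
  ext i j
  simp [scalarSandwich, Finset.sum_add_distrib]

@[simp] lemma scalarSandwich_zero_left (v : Matrix (Fin n) (Fin p) V)
    (β : Matrix (Fin p) (Fin q) ℂ) :
    scalarSandwich (0 : Matrix (Fin m) (Fin n) ℂ) v β = 0 := by
  ext i j
  simp [scalarSandwich]

@[simp] lemma scalarSandwich_zero_right (α : Matrix (Fin m) (Fin n) ℂ)
    (v : Matrix (Fin n) (Fin p) V) :
    scalarSandwich α v (0 : Matrix (Fin p) (Fin q) ℂ) = 0 := by
  ext i j
  simp [scalarSandwich]

@[simp] lemma scalarSandwich_zero (α : Matrix (Fin m) (Fin n) ℂ) (β : Matrix (Fin p) (Fin q) ℂ) :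
    scalarSandwich α (0 : Matrix (Fin n) (Fin p) V) β = 0 := by
  ext i j
  simp [scalarSandwich]

lemma scalarSandwich_smul_one (c d : ℂ) (v : Matrix (Fin n) (Fin p) V) :
    scalarSandwich (c • 1) v (d • 1) = (c * d) • v := by
  ext i j
  simp [scalarSandwich, Matrix.one_apply, ite_smul]

lemma scalarSandwich_one (v : Matrix (Fin n) (Fin p) V) : scalarSandwich 1 v 1 = v := by
  simpa using scalarSandwich_smul_one 1 1 v

lemma scalarSandwich_scalarSandwich (α : Matrix (Fin m) (Fin n) ℂ) (β : Matrix (Fin n) (Fin p) ℂ)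
    (v : Matrix (Fin p) (Fin q) V) (γ : Matrix (Fin q) (Fin r) ℂ) (δ : Matrix (Fin r) (Fin s) ℂ) :
    scalarSandwich α (scalarSandwich β v γ) δ = scalarSandwich (α * β) v (γ * δ) := by
  ext i j
  simp only [scalarSandwich, Matrix.of_apply, Matrix.mul_apply, Finset.smul_sum, smul_smul,
    Finset.sum_mul, Finset.mul_sum, Finset.sum_smul]
  calc _ = ∑ k, ∑ x, ∑ l, ∑ y, (α i k * δ l j * (β k x * γ y l)) • v x y :=
        Finset.sum_congr rfl fun k _ => Finset.sum_comm
    _ = ∑ x, ∑ k, ∑ l, ∑ y, (α i k * δ l j * (β k x * γ y l)) • v x y := Finset.sum_comm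
    _ = ∑ x, ∑ k, ∑ y, ∑ l, (α i k * δ l j * (β k x * γ y l)) • v x y :=
        Finset.sum_congr rfl fun x _ => Finset.sum_congr rfl fun k _ => Finset.sum_comm
    _ = ∑ x, ∑ y, ∑ k, ∑ l, (α i k * δ l j * (β k x * γ y l)) • v x y :=
        Finset.sum_congr rfl fun x _ => Finset.sum_comm
    _ = ∑ x, ∑ y, ∑ l, ∑ k, (α i k * δ l j * (β k x * γ y l)) • v x y :=
        Finset.sum_congr rfl fun x _ => Finset.sum_congr rfl fun y _ => Finset.sum_comm
    _ = _ := by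
        refine Finset.sum_congr rfl fun x _ => Finset.sum_congr rfl fun y _ =>
          Finset.sum_congr rfl fun l _ => Finset.sum_congr rfl fun k _ => ?_
        congr 1
        ring

lemma scalarSandwich_map {W : Type*} [AddCommGroup W] [Module ℂ W] (f : V →ₗ[ℂ] W)
    (α : Matrix (Fin m) (Fin n) ℂ) (v : Matrix (Fin n) (Fin p) V) (β : Matrix (Fin p) (Fin q) ℂ) :
    (scalarSandwich α v β).map f = scalarSandwich α (v.map f) β := by
  ext i j
  simp [scalarSandwich]

lemma scalarSandwich_eq_mul (α : Matrix (Fin m) (Fin n) ℂ) (A : Matrix (Fin n) (Fin p) ℂ)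
    (β : Matrix (Fin p) (Fin q) ℂ) : scalarSandwich α A β = α * A * β := by
  ext i j
  simp only [scalarSandwich, Matrix.of_apply, Matrix.mul_apply, Finset.sum_mul, smul_eq_mul]
  rw [Finset.sum_comm]
  refine Finset.sum_congr rfl fun l _ => Finset.sum_congr rfl fun k _ => ?_
  ring

lemma scalarSandwich_conjTranspose [StarAddMonoid V] [StarModule ℂ V]
    (α : Matrix (Fin m) (Fin n) ℂ) (v : Matrix (Fin n) (Fin p) V) (β : Matrix (Fin p) (Fin q) ℂ) :
    (scalarSandwich α v β)ᴴ = scalarSandwich βᴴ vᴴ αᴴ := by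
  ext i j
  simp only [scalarSandwich, Matrix.conjTranspose_apply, Matrix.of_apply, star_sum, star_smul,
    star_mul]
  rw [Finset.sum_comm]

end SandwichAlgebra

/-! ### Positive scalar matrices and shifted square roots. -/

section ScalarMatrices

open scoped ComplexOrder

lemma posSemidef_of_forall_add_smul_one {n : ℕ} {A : Matrix (Fin n) (Fin n) ℂ}
    (h : ∀ ε : ℝ, 0 < ε → (A + (ε : ℂ) • (1 : Matrix (Fin n) (Fin n) ℂ)).PosSemidef) :
    A.PosSemidef := by
  rw [Matrix.posSemidef_iff_dotProduct_mulVec]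
  constructor
  · have h1 := (h 1 one_pos).isHermitian.sub (Matrix.isHermitian_one (α := ℂ) (n := Fin n))
    simpa using h1
  · intro x
    have hlim : Filter.Tendsto
        (fun ε : ℝ => star x ⬝ᵥ (A + (ε : ℂ) • (1 : Matrix (Fin n) (Fin n) ℂ)) *ᵥ x)
        (nhdsWithin 0 (Set.Ioi 0)) (nhds (star x ⬝ᵥ A *ᵥ x)) := by
      have hc : Continuous
          (fun ε : ℝ => star x ⬝ᵥ (A + (ε : ℂ) • (1 : Matrix (Fin n) (Fin n) ℂ)) *ᵥ x) := by
        simp only [Matrix.add_mulVec, Matrix.smul_mulVec, Matrix.one_mulVec, dotProduct_add,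
          dotProduct_smul]
        fun_prop
      simpa using (hc.tendsto 0).mono_left nhdsWithin_le_nhds
    refine ge_of_tendsto hlim ?_
    filter_upwards [self_mem_nhdsWithin] with ε hε
    exact (h ε hε).dotProduct_mulVec_nonneg x

-- The C*-identity `‖β* β‖ = ‖β‖²`; it lets order bounds on `β* β` control compressions in norm.
open scoped Matrix.Norms.L2Operator MatrixOrder in
lemma norm_le_one_of_posSemidef {m n : ℕ} {β : Matrix (Fin m) (Fin n) ℂ}
    (h : (1 - βᴴ * β).PosSemidef) : ‖β‖ ≤ 1 := by
  have h1 : ‖βᴴ * β‖ ≤ 1 :=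
    (CStarAlgebra.norm_le_one_iff_of_nonneg _
      (Matrix.posSemidef_conjTranspose_mul_self β).nonneg).2 (Matrix.le_iff.2 h)
  rw [Matrix.l2_opNorm_conjTranspose_mul_self] at h1
  nlinarith [norm_nonneg β]

open scoped Matrix.Norms.L2Operator MatrixOrder in
lemma exists_posSemidef_smul_one_add {n : ℕ} {A : Matrix (Fin n) (Fin n) ℂ} (hA : A.IsHermitian) :
    ∃ s : ℝ, 0 ≤ s ∧ ((s : ℂ) • (1 : Matrix (Fin n) (Fin n) ℂ) + A).PosSemidef := by
  refine ⟨‖A‖, norm_nonneg A, ?_⟩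
  have h := Matrix.le_iff.1 (IsSelfAdjoint.neg_algebraMap_norm_le_self (a := A) hA)
  rw [Algebra.algebraMap_eq_smul_one] at h
  have e : A - -(‖A‖ • (1 : Matrix (Fin n) (Fin n) ℂ)) = (‖A‖ : ℂ) • 1 + A := by
    rw [Complex.coe_smul]; abel
  rwa [e] at h

lemma posSemidef_smul_one {n : ℕ} {t : ℝ} (ht : 0 ≤ t) :
    ((t : ℂ) • (1 : Matrix (Fin n) (Fin n) ℂ)).PosSemidef :=
  Matrix.PosSemidef.one.smul (by exact_mod_cast ht)

section ShiftedSqrt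

variable {n : ℕ} {A : Matrix (Fin n) (Fin n) ℂ} {ε : ℝ}

lemma posDef_add_smul_one (hA : A.PosSemidef) (hε : 0 < ε) :
    (A + (ε : ℂ) • (1 : Matrix (Fin n) (Fin n) ℂ)).PosDef :=
  Matrix.PosDef.posSemidef_add hA (Matrix.PosDef.one.smul (by exact_mod_cast hε))

open scoped MatrixOrder in
lemma shiftedSqrt_mul_self (hA : A.PosSemidef) (hε : 0 < ε) :
    shiftedSqrt A ε * shiftedSqrt A ε = A + (ε : ℂ) • 1 :=
  CFC.sqrt_mul_sqrt_self _ (posDef_add_smul_one hA hε).posSemidef.nonneg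

open scoped MatrixOrder in
lemma shiftedSqrt_conjTranspose (A : Matrix (Fin n) (Fin n) ℂ) (ε : ℝ) :
    (shiftedSqrt A ε)ᴴ = shiftedSqrt A ε :=
  (Matrix.nonneg_iff_posSemidef.1 (CFC.sqrt_nonneg _)).isHermitian

open scoped MatrixOrder in
lemma isUnit_det_shiftedSqrt (hA : A.PosSemidef) (hε : 0 < ε) :
    IsUnit (shiftedSqrt A ε).det := by
  rw [← Matrix.isUnit_iff_isUnit_det]
  exact (CFC.isUnit_sqrt_iff _ (posDef_add_smul_one hA hε).posSemidef.nonneg).2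
    (posDef_add_smul_one hA hε).isUnit

lemma inv_shiftedSqrt_conjTranspose (A : Matrix (Fin n) (Fin n) ℂ) (ε : ℝ) :
    (shiftedSqrt A ε)⁻¹ᴴ = (shiftedSqrt A ε)⁻¹ := by
  rw [Matrix.conjTranspose_nonsing_inv, shiftedSqrt_conjTranspose]

end ShiftedSqrt

end ScalarMatrices

/-! ### Matrix orders and matrix norms. -/

section MatrixOrder

variable {V : Type*} [AddCommGroup V] [Module ℂ V] [StarAddMonoid V] {C : MatrixCones V}

namespace IsMatrixOrder

lemma zero_mem (hC : IsMatrixOrder C) (n : ℕ) : (0 : Matrix (Fin n) (Fin n) V) ∈ C n := by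
  obtain ⟨v, hv⟩ := hC.nonempty n
  simpa using hC.compress_mem n n 0 v hv

lemma smul_mem (hC : IsMatrixOrder C) {n : ℕ} {t : ℝ} (ht : 0 ≤ t) {v : Matrix (Fin n) (Fin n) V}
    (hv : v ∈ C n) : (t : ℂ) • v ∈ C n := by
  have h := hC.compress_mem n n ((Real.sqrt t : ℂ) • 1) v hv
  rw [Matrix.conjTranspose_smul, Matrix.conjTranspose_one, scalarSandwich_smul_one] at h
  have e : star (Real.sqrt t : ℂ) * (Real.sqrt t : ℂ) = (t : ℂ) := by
    rw [Complex.star_def, Complex.conj_ofReal, ← Complex.ofReal_mul, Real.mul_self_sqrt ht]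
  rwa [e] at h

lemma blockMatrix_diag_mem (hC : IsMatrixOrder C) {m n : ℕ} {v : Matrix (Fin m) (Fin m) V}
    {w : Matrix (Fin n) (Fin n) V} (hv : v ∈ C m) (hw : w ∈ C n) :
    blockMatrix v 0 0 w ∈ C (m + n) := by
  have h1 := hC.compress_mem m (m + n) (hstack 1 0) v hv
  have h2 := hC.compress_mem n (m + n) (hstack 0 1) w hw
  rw [scalarSandwich_hstack] at h1 h2
  have h := hC.add_mem _ _ h1 _ h2
  rw [blockMatrix_add] at h
  simpa [scalarSandwich_one] using h

end IsMatrixOrder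

end MatrixOrder

section MatrixNorm

variable {V : Type*} [AddCommGroup V] [Module ℂ V] {N : MatrixNorms V}

namespace IsLInftyMatrixNorm

/-- The matrix norm at a fixed level as a seminorm. -/
noncomputable def seminorm (hN : IsLInftyMatrixNorm N) (n : ℕ) : Seminorm ℂ (Matrix (Fin n) (Fin n) V) :=
  Seminorm.of (N n) (hN.add_le n) (hN.smul_eq n)

lemma nonneg (hN : IsLInftyMatrixNorm N) {n : ℕ} (v : Matrix (Fin n) (Fin n) V) : 0 ≤ N n v :=
  apply_nonneg (hN.seminorm n) v

lemma map_zero (hN : IsLInftyMatrixNorm N) (n : ℕ) : N n 0 = 0 :=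
  _root_.map_zero (hN.seminorm n)

lemma map_neg (hN : IsLInftyMatrixNorm N) {n : ℕ} (v : Matrix (Fin n) (Fin n) V) :
    N n (-v) = N n v :=
  map_neg_eq_map (hN.seminorm n) v

lemma smul_real (hN : IsLInftyMatrixNorm N) {n : ℕ} {t : ℝ} (ht : 0 ≤ t)
    (v : Matrix (Fin n) (Fin n) V) : N n ((t : ℂ) • v) = t * N n v := by
  rw [hN.smul_eq, Complex.norm_of_nonneg ht]

open scoped ComplexOrder Matrix.Norms.L2Operator in
lemma compress_le (hN : IsLInftyMatrixNorm N) {m n : ℕ} {β : Matrix (Fin m) (Fin n) ℂ}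
    (hβ : (1 - βᴴ * β).PosSemidef) (u : Matrix (Fin m) (Fin m) V) :
    N n (scalarSandwich βᴴ u β) ≤ N m u := by
  have h1 := norm_le_one_of_posSemidef hβ
  have h2 : ‖βᴴ‖ ≤ 1 := by rwa [Matrix.l2_opNorm_conjTranspose]
  calc N n (scalarSandwich βᴴ u β) ≤ ‖βᴴ‖ * N m u * ‖β‖ := hN.sandwich_le _ _ _ _ _
    _ ≤ 1 * N m u * 1 := by
      have := hN.nonneg u
      gcongr
    _ = N m u := by ring

end IsLInftyMatrixNorm

end MatrixNorm

/-! ### The dominating gauge and positive contractive functionals. -/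

section RieszNormed

open scoped ComplexOrder

variable {X : Type*} [AddCommGroup X] [Module ℂ X] [StarAddMonoid X]
  {C : MatrixCones X} {N : MatrixNorms X}

namespace IsLInftyMatricialRieszNormed

/-- The mean of the two diagonal entries in the Riesz formula works; doubling the inequality avoids
halving `y + y*`. -/
lemma exists_dominating (hX : IsLInftyMatricialRieszNormed C N) {n : ℕ}
    (y : Matrix (Fin n) (Fin n) X) {r : ℝ} (hr : N n y < r) :
    ∃ u ∈ C n, (2 : ℂ) • u - (y + yᴴ) ∈ C n ∧ N n u < r := by
  obtain ⟨_, ⟨u₁, h₁, u₂, h₂, hb, rfl⟩, -, hlt⟩ := (hX.riesz n y).exists_between hr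
  have hC := hX.matrixOrder
  have hN := hX.matrixNorm
  have e : (2 : ℂ) • (((2⁻¹ : ℝ) : ℂ) • (u₁ + u₂)) = u₁ + u₂ := by
    rw [smul_smul]; norm_num
  refine ⟨((2⁻¹ : ℝ) : ℂ) • (u₁ + u₂),
    hC.smul_mem (by norm_num) (hC.add_mem _ _ h₁ _ h₂), ?_, ?_⟩
  -- Compression by the column `(1, -1)` gives `u₁ + u₂ - y - y*`.
  · have h := hC.compress_mem (n + n) n (vstack ((1 : ℂ) • 1) ((-1 : ℂ) • 1)) _ hb
    rw [scalarSandwich_vstack] at h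
    simp only [Matrix.conjTranspose_smul, Matrix.conjTranspose_one, scalarSandwich_smul_one] at h
    rw [e]
    convert h using 1
    simp
    abel
  · rw [hN.smul_real (by norm_num)]
    have := hN.add_le n u₁ u₂
    have := (max_lt_iff.1 hlt).1
    have := (max_lt_iff.1 hlt).2
    linarith

/-- The positive blocks `[[v, v], [v, v]]` and `[[-v, v], [v, -v]]` add up to one with zero diagonal
and corner `2v`, so the Riesz formula gives `‖2v‖ ≤ 0`. -/
lemma eq_zero_of_mem_of_neg_mem (hX : IsLInftyMatricialRieszNormed C N) {n : ℕ}
    {v : Matrix (Fin n) (Fin n) X} (hv : v ∈ C n) (hv' : -v ∈ C n) : v = 0 := by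
  have hC := hX.matrixOrder
  have hN := hX.matrixNorm
  have hs : vᴴ = v := hC.isHermitian n v hv
  have h1 := hC.compress_mem n (n + n) (hstack ((1 : ℂ) • 1) ((1 : ℂ) • 1)) _ hv
  have h2 := hC.compress_mem n (n + n) (hstack ((1 : ℂ) • 1) ((-1 : ℂ) • 1)) _ hv'
  rw [scalarSandwich_hstack] at h1 h2
  have h := hC.add_mem _ _ h1 _ h2
  rw [blockMatrix_add] at h
  simp only [Matrix.conjTranspose_smul, Matrix.conjTranspose_one, scalarSandwich_smul_one] at h
  have h' : blockMatrix 0 (v + v) (v + v)ᴴ 0 ∈ C (n + n) := by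
    rw [Matrix.conjTranspose_add, hs]
    simpa using h
  have hle : N n (v + v) ≤ 0 := by
    refine (hX.riesz n (v + v)).1 ⟨0, hC.zero_mem n, 0, hC.zero_mem n, h', ?_⟩
    simp [hN.map_zero]
  have h0 := hN.eq_zero n _ (le_antisymm hle (hN.nonneg _))
  rw [← two_smul ℂ] at h0
  exact (smul_eq_zero.1 h0).resolve_left two_ne_zero

/-- The least norm of a positive element dominating the real part of `y`. -/
noncomputable def dominatingGauge (_ : IsLInftyMatricialRieszNormed C N) {n : ℕ}
    (y : Matrix (Fin n) (Fin n) X) : ℝ :=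
  sInf {r : ℝ | ∃ u ∈ C n, (2 : ℂ) • u - (y + yᴴ) ∈ C n ∧ r = N n u}

section Gauge

variable (hX : IsLInftyMatricialRieszNormed C N) {n : ℕ} (y z : Matrix (Fin n) (Fin n) X)

lemma dominatingGauge_le {u : Matrix (Fin n) (Fin n) X} (hu : u ∈ C n)
    (h : (2 : ℂ) • u - (y + yᴴ) ∈ C n) : hX.dominatingGauge y ≤ N n u :=
  csInf_le ⟨0, by rintro _ ⟨u, -, -, rfl⟩; exact hX.matrixNorm.nonneg u⟩ ⟨u, hu, h, rfl⟩

lemma exists_of_dominatingGauge_lt {r : ℝ} (hr : hX.dominatingGauge y < r) :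
    ∃ u ∈ C n, (2 : ℂ) • u - (y + yᴴ) ∈ C n ∧ N n u < r := by
  obtain ⟨u, hu, h, -⟩ := hX.exists_dominating y (lt_add_one (N n y))
  have hne : {r : ℝ | ∃ u ∈ C n, (2 : ℂ) • u - (y + yᴴ) ∈ C n ∧ r = N n u}.Nonempty :=
    ⟨N n u, u, hu, h, rfl⟩
  obtain ⟨_, ⟨u, hu, h, rfl⟩, hlt⟩ := exists_lt_of_csInf_lt hne hr
  exact ⟨u, hu, h, hlt⟩

lemma dominatingGauge_nonneg : 0 ≤ hX.dominatingGauge y :=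
  Real.sInf_nonneg (by rintro _ ⟨u, -, -, rfl⟩; exact hX.matrixNorm.nonneg u)

lemma dominatingGauge_le_norm : hX.dominatingGauge y ≤ N n y := by
  refine le_of_forall_gt_imp_ge_of_dense fun r hr => ?_
  obtain ⟨u, hu, h, hlt⟩ := hX.exists_dominating y hr
  exact (hX.dominatingGauge_le y hu h).trans hlt.le

lemma dominatingGauge_add :
    hX.dominatingGauge (y + z) ≤ hX.dominatingGauge y + hX.dominatingGauge z := by
  refine le_of_forall_pos_le_add fun δ hδ => ?_
  obtain ⟨u, hu, h, hlt⟩ := hX.exists_of_dominatingGauge_lt y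
    (lt_add_of_pos_right (hX.dominatingGauge y) (half_pos hδ))
  obtain ⟨u', hu', h', hlt'⟩ := hX.exists_of_dominatingGauge_lt z
    (lt_add_of_pos_right (hX.dominatingGauge z) (half_pos hδ))
  have hC := hX.matrixOrder
  have hle := hX.dominatingGauge_le (y + z) (hC.add_mem _ _ hu _ hu') (by
    convert hC.add_mem _ _ h _ h' using 1
    rw [Matrix.conjTranspose_add, smul_add]
    abel)
  have := hX.matrixNorm.add_le n u u'
  linarith

lemma dominatingGauge_zero : hX.dominatingGauge (0 : Matrix (Fin n) (Fin n) X) = 0 :=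
  le_antisymm (by simpa [hX.matrixNorm.map_zero] using hX.dominatingGauge_le_norm 0)
    (hX.dominatingGauge_nonneg 0)

variable [StarModule ℂ X]

lemma dominatingGauge_smul_le {c : ℝ} (hc : 0 < c) :
    hX.dominatingGauge (c • y) ≤ c * hX.dominatingGauge y := by
  have hC := hX.matrixOrder
  rw [← div_le_iff₀' hc]
  refine le_of_forall_gt_imp_ge_of_dense fun r hr => ?_
  obtain ⟨u, hu, h, hlt⟩ := hX.exists_of_dominatingGauge_lt y hr
  have hle := hX.dominatingGauge_le (c • y) (hC.smul_mem hc.le hu) (by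
    convert hC.smul_mem hc.le h using 1
    rw [← Complex.coe_smul c y, Matrix.conjTranspose_smul, Complex.star_def, Complex.conj_ofReal,
      smul_sub, smul_add, smul_comm])
  rw [hX.matrixNorm.smul_real hc.le] at hle
  rw [div_le_iff₀' hc]
  exact hle.trans (by gcongr)

lemma dominatingGauge_smul {c : ℝ} (hc : 0 < c) :
    hX.dominatingGauge (c • y) = c * hX.dominatingGauge y := by
  refine le_antisymm (hX.dominatingGauge_smul_le y hc) ?_
  have h := hX.dominatingGauge_smul_le (c • y) (inv_pos.2 hc)
  rwa [smul_smul, inv_mul_cancel₀ hc.ne', one_smul, inv_mul_eq_div, le_div_iff₀' hc] at h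

/-- The gauge of `y` is attained at the real part of a positive contractive functional. -/
lemma exists_functional_eq_dominatingGauge :
    ∃ φ : Matrix (Fin n) (Fin n) X →ₗ[ℂ] ℂ, IsPositiveContractive C N φ ∧
      (φ y).re = hX.dominatingGauge y := by
  have hC := hX.matrixOrder
  have hN := hX.matrixNorm
  -- Real Hahn-Banach, extending `c • y ↦ c * gauge y` from the line through `y`; for `c < 0`
  -- domination holds because the gauge is nonnegative.
  obtain ⟨f, hf, hle⟩ := exists_extension_of_le_sublinear
    (LinearPMap.mkSpanSingleton' (σ := RingHom.id ℝ) y (hX.dominatingGauge y) (by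
      intro c hc
      rcases smul_eq_zero.1 hc with rfl | rfl
      · simp
      · simp [hX.dominatingGauge_zero]))
    hX.dominatingGauge (fun c hc v => hX.dominatingGauge_smul v hc) hX.dominatingGauge_add (by
      rintro ⟨v, hv⟩
      obtain ⟨c, rfl⟩ := Submodule.mem_span_singleton.1 hv
      rw [LinearPMap.mkSpanSingleton'_apply]
      simp only [RingHom.id_apply, smul_eq_mul]
      rcases lt_trichotomy c 0 with hc | rfl | hc
      · exact (mul_nonpos_of_nonpos_of_nonneg hc.le (hX.dominatingGauge_nonneg y)).trans
          (hX.dominatingGauge_nonneg _)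
      · simp [hX.dominatingGauge_zero]
      · exact (hX.dominatingGauge_smul y hc).ge)
  have hfy : f y = hX.dominatingGauge y := by
    have hm : (1 : ℝ) • y ∈ Submodule.span ℝ {y} :=
      Submodule.smul_mem _ _ (Submodule.mem_span_singleton_self y)
    have h := hf ⟨(1 : ℝ) • y, hm⟩
    erw [LinearPMap.mkSpanSingleton'_apply] at h
    simpa using h
  -- If the real part of `v` is nonpositive, `0` dominates it and the gauge is `0`.
  have hpos : ∀ v, -(v + vᴴ) ∈ C n → f v ≤ 0 := fun v hv => by
    refine (hle v).trans ?_
    simpa [hN.map_zero] using hX.dominatingGauge_le v (hC.zero_mem n) (by simpa using hv)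
  have habs : ∀ v, |f v| ≤ hN.seminorm n v := fun v => by
    refine abs_le.2 ⟨?_, (hle v).trans (hX.dominatingGauge_le_norm v)⟩
    have h := (hle (-v)).trans (hX.dominatingGauge_le_norm (-v))
    rw [hN.map_neg, _root_.map_neg] at h
    exact neg_le.1 h
  refine ⟨Module.Dual.extendRCLike (𝕜 := ℂ) f, ⟨fun c hc => ?_, fun v => ?_⟩, ?_⟩
  · have hs : cᴴ = c := hC.isHermitian n c hc
    have h1 : 0 ≤ f c := by
      have h := hpos (-c) (by
        rw [Matrix.conjTranspose_neg, hs]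
        simpa using hC.add_mem _ _ hc _ hc)
      rw [_root_.map_neg] at h
      linarith
    -- A skew-adjoint element has real part `0`, so `f` vanishes on it; at `i c` this kills the
    -- imaginary part of the extension.
    have hI : ∀ v : Matrix (Fin n) (Fin n) X, v + vᴴ = 0 → f v ≤ 0 := fun v hv =>
      hpos v (by rw [hv, neg_zero]; exact hC.zero_mem n)
    have h2 : f (Complex.I • c) = 0 := by
      refine le_antisymm (hI _ ?_) ?_
      · rw [Matrix.conjTranspose_smul, hs]; simp
      · have h := hI (-(Complex.I • c)) (by
          rw [Matrix.conjTranspose_neg, Matrix.conjTranspose_smul, hs]; simp)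
        rw [_root_.map_neg] at h
        linarith
    rw [Module.Dual.extendRCLike_apply]
    simp only [RCLike.I_to_complex, h2]
    simpa using h1
  · exact Module.Dual.norm_extendRCLike_le_seminorm f habs v
  · rw [← RCLike.re_to_complex, Module.Dual.re_extendRCLike_apply, hfy]

end Gauge

end IsLInftyMatricialRieszNormed

end RieszNormed

/-! ### Karn's unitization is an operator system. -/

section Unitization

open scoped ComplexOrder

lemma Matrix.IsHermitian.map_fst {X : Type*} [Star X] {n : ℕ}
    {w : Matrix (Fin n) (Fin n) (X × ℂ)} (hw : w.IsHermitian) :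
    (w.map Prod.fst).IsHermitian :=
  hw.map _ fun _ => rfl

lemma Matrix.IsHermitian.map_snd {X : Type*} [Star X] {n : ℕ}
    {w : Matrix (Fin n) (Fin n) (X × ℂ)} (hw : w.IsHermitian) :
    (w.map Prod.snd).IsHermitian :=
  hw.map _ fun _ => rfl

section Components

variable {X : Type*} [AddCommGroup X] [Module ℂ X] {n : ℕ}

lemma map_fst_unitMatrix_add (t : ℝ) (w : Matrix (Fin n) (Fin n) (X × ℂ)) :
    (unitMatrix ((0, 1) : X × ℂ) n t + w).map Prod.fst = w.map Prod.fst := by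
  ext i j
  by_cases h : i = j <;> simp [unitMatrix, h]

lemma map_snd_unitMatrix_add (t : ℝ) (w : Matrix (Fin n) (Fin n) (X × ℂ)) :
    (unitMatrix ((0, 1) : X × ℂ) n t + w).map Prod.snd = (t : ℂ) • 1 + w.map Prod.snd := by
  ext i j
  by_cases h : i = j <;> simp [unitMatrix, h]

lemma map_fst_scalarSandwich {m : ℕ} (γ : Matrix (Fin m) (Fin n) ℂ)
    (w : Matrix (Fin m) (Fin m) (X × ℂ)) :
    (scalarSandwich γᴴ w γ).map Prod.fst = scalarSandwich γᴴ (w.map Prod.fst) γ :=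
  scalarSandwich_map (LinearMap.fst ℂ X ℂ) _ _ _

lemma map_snd_scalarSandwich {m : ℕ} (γ : Matrix (Fin m) (Fin n) ℂ)
    (w : Matrix (Fin m) (Fin m) (X × ℂ)) :
    (scalarSandwich γᴴ w γ).map Prod.snd = γᴴ * w.map Prod.snd * γ :=
  (scalarSandwich_map (LinearMap.snd ℂ X ℂ) _ _ _).trans (scalarSandwich_eq_mul _ _ _)

variable [StarAddMonoid X]

lemma isHermitian_unitMatrix (t : ℝ) : (unitMatrix ((0, 1) : X × ℂ) n t).IsHermitian := by
  refine Matrix.isHermitian_diagonal_of_self_adjoint _ ?_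
  ext i <;> simp

end Components

namespace IsLInftyMatricialRieszNormed

variable {X : Type*} [AddCommGroup X] [Module ℂ X] [StarAddMonoid X]
  {C : MatrixCones X} {N : MatrixNorms X}

/-- A compression `β* u β` with `β* β ≤ A + ε` factors through `(A + ε)^{1/2}`. -/
lemma exists_eq_shiftedSqrt_sandwich (hX : IsLInftyMatricialRieszNormed C N) {m n : ℕ}
    {A : Matrix (Fin n) (Fin n) ℂ} (hA : A.PosSemidef) {ε : ℝ} (hε : 0 < ε)
    {β : Matrix (Fin m) (Fin n) ℂ} (hβ : (A + (ε : ℂ) • 1 - βᴴ * β).PosSemidef)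
    {u : Matrix (Fin m) (Fin m) X} (hu : u ∈ C m) (hu1 : N m u < 1) :
    ∃ u' ∈ C n, N n u' < 1 ∧
      scalarSandwich (shiftedSqrt A ε) u' (shiftedSqrt A ε) = scalarSandwich βᴴ u β := by
  set S := shiftedSqrt A ε with hS
  have hdet : IsUnit S.det := isUnit_det_shiftedSqrt hA hε
  have hinv : S⁻¹ᴴ = S⁻¹ := inv_shiftedSqrt_conjTranspose A ε
  refine ⟨scalarSandwich (β * S⁻¹)ᴴ u (β * S⁻¹), hX.matrixOrder.compress_mem _ _ _ _ hu,
    (hX.matrixNorm.compress_le ?_ u).trans_lt hu1, ?_⟩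
  · have h := hβ.conjTranspose_mul_mul_same S⁻¹
    rw [← shiftedSqrt_mul_self hA hε, ← hS, hinv] at h
    convert h using 1
    rw [Matrix.conjTranspose_mul, hinv, Matrix.mul_sub, Matrix.sub_mul, ← Matrix.mul_assoc S⁻¹ S S,
      Matrix.nonsing_inv_mul _ hdet, Matrix.one_mul, Matrix.mul_nonsing_inv _ hdet]
    simp only [Matrix.mul_assoc]
  · rw [scalarSandwich_scalarSandwich, Matrix.conjTranspose_mul, hinv, ← Matrix.mul_assoc,
      Matrix.mul_nonsing_inv _ hdet, Matrix.one_mul, Matrix.mul_assoc,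
      Matrix.nonsing_inv_mul _ hdet, Matrix.mul_one]

/-- Karn's cones described by arbitrary compressions `β* u β` with `β* β ≤ A + ε`. -/
lemma mem_karnCones_iff (hX : IsLInftyMatricialRieszNormed C N) {n : ℕ}
    {w : Matrix (Fin n) (Fin n) (X × ℂ)} :
    w ∈ karnCones C N n ↔ w.IsHermitian ∧ (w.map Prod.snd).PosSemidef ∧
      ∀ ε : ℝ, 0 < ε → ∃ (m : ℕ) (β : Matrix (Fin m) (Fin n) ℂ), ∃ u ∈ C m, N m u < 1 ∧
        (w.map Prod.snd + (ε : ℂ) • 1 - βᴴ * β).PosSemidef ∧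
        w.map Prod.fst + scalarSandwich βᴴ u β ∈ C n := by
  refine and_congr_right fun hw => and_congr_right fun hA => forall₂_congr fun ε hε => ?_
  constructor
  · rintro ⟨u, hu, hu1, h⟩
    refine ⟨n, shiftedSqrt (w.map Prod.snd) ε, u, hu, hu1, ?_, ?_⟩
    · rw [shiftedSqrt_conjTranspose, shiftedSqrt_mul_self hA hε, sub_self]
      exact Matrix.PosSemidef.zero
    · rwa [shiftedSqrt_conjTranspose]
  · rintro ⟨m, β, u, hu, hu1, hβ, h⟩
    obtain ⟨u', hu', hu1', e⟩ := hX.exists_eq_shiftedSqrt_sandwich hA hε hβ hu hu1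
    exact ⟨u', hu', hu1', by rwa [e]⟩

lemma karnCones_add_mem (hX : IsLInftyMatricialRieszNormed C N) {n : ℕ}
    {v w : Matrix (Fin n) (Fin n) (X × ℂ)} (hv : v ∈ karnCones C N n)
    (hw : w ∈ karnCones C N n) : v + w ∈ karnCones C N n := by
  rw [hX.mem_karnCones_iff] at *
  obtain ⟨hv, hA, H⟩ := hv
  obtain ⟨hw, hB, K⟩ := hw
  have e₁ : (v + w).map Prod.fst = v.map Prod.fst + w.map Prod.fst := rfl
  have e₂ : (v + w).map Prod.snd = v.map Prod.snd + w.map Prod.snd := rfl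
  rw [e₁, e₂]
  refine ⟨hv.add hw, hA.add hB, fun ε hε => ?_⟩
  obtain ⟨m, β, u, hu, hu1, hβ, h⟩ := H (ε / 2) (half_pos hε)
  obtain ⟨m', β', u', hu', hu1', hβ', h'⟩ := K (ε / 2) (half_pos hε)
  refine ⟨m + m', vstack β β', blockMatrix u 0 0 u', hX.matrixOrder.blockMatrix_diag_mem hu hu',
    ?_, ?_, ?_⟩
  · rw [hX.matrixNorm.directSum_eq]
    exact max_lt hu1 hu1'
  · convert hβ.add hβ' using 1
    have e : (ε : ℂ) • (1 : Matrix (Fin n) (Fin n) ℂ) =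
        ((ε / 2 : ℝ) : ℂ) • 1 + ((ε / 2 : ℝ) : ℂ) • 1 := by
      rw [← add_smul, ← Complex.ofReal_add, add_halves]
    rw [conjTranspose_vstack_mul_vstack, e]
    abel
  · convert hX.matrixOrder.add_mem _ _ h _ h' using 1
    rw [scalarSandwich_vstack]
    simp only [scalarSandwich_zero, add_zero]
    abel

lemma karnCones_compress_mem [StarModule ℂ X] (hX : IsLInftyMatricialRieszNormed C N) {m n : ℕ}
    (γ : Matrix (Fin m) (Fin n) ℂ) {w : Matrix (Fin m) (Fin m) (X × ℂ)}
    (hw : w ∈ karnCones C N m) : scalarSandwich γᴴ w γ ∈ karnCones C N n := by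
  rw [hX.mem_karnCones_iff] at *
  obtain ⟨hw, hA, H⟩ := hw
  rw [map_fst_scalarSandwich, map_snd_scalarSandwich]
  refine ⟨?_, hA.conjTranspose_mul_mul_same γ, fun ε hε => ?_⟩
  · rw [Matrix.IsHermitian, scalarSandwich_conjTranspose, Matrix.conjTranspose_conjTranspose, hw]
  -- Here `γ* γ ≤ s`, so a slack of `ε / (s + 1)` before compression costs at most `ε` after it; the
  -- `+ 1` keeps the divisor positive.
  obtain ⟨s, hs, hγ⟩ := exists_posSemidef_smul_one_add
    (Matrix.isHermitian_conjTranspose_mul_self γ).neg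
  have hs1 : 0 < s + 1 := by linarith
  obtain ⟨k, β, u, hu, hu1, hβ, h⟩ := H (ε / (s + 1)) (div_pos hε hs1)
  refine ⟨k, β * γ, u, hu, hu1, ?_, ?_⟩
  · have h1 := (hβ.conjTranspose_mul_mul_same γ).add
      ((hγ.add (posSemidef_smul_one zero_le_one)).smul
        (show (0 : ℂ) ≤ ((ε / (s + 1) : ℝ) : ℂ) by exact_mod_cast (div_pos hε hs1).le))
    convert h1 using 1
    have e : (ε : ℂ) = ((ε / (s + 1) : ℝ) : ℂ) * ((s : ℂ) + ((1 : ℝ) : ℂ)) := by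
      rw [← Complex.ofReal_add, ← Complex.ofReal_mul, div_mul_cancel₀ _ hs1.ne']
    rw [Matrix.conjTranspose_mul, e, Matrix.mul_sub, Matrix.mul_add, Matrix.sub_mul,
      Matrix.add_mul, mul_smul, add_smul]
    simp only [smul_add, smul_neg, Matrix.mul_smul, Matrix.smul_mul, Matrix.mul_one,
      Matrix.mul_assoc]
    abel
  · convert hX.matrixOrder.compress_mem _ _ γ _ h using 1
    rw [scalarSandwich_add, scalarSandwich_scalarSandwich, Matrix.conjTranspose_mul]

lemma karnCones_isMatrixOrder [StarModule ℂ X] (hX : IsLInftyMatricialRieszNormed C N) :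
    IsMatrixOrder (karnCones C N) where
  nonempty n := by
    refine ⟨0, Matrix.isHermitian_zero, Matrix.PosSemidef.zero, fun ε hε =>
      ⟨0, hX.matrixOrder.zero_mem n, ?_, ?_⟩⟩
    · rw [hX.matrixNorm.map_zero]; exact zero_lt_one
    · rw [scalarSandwich_zero, add_zero]; exact hX.matrixOrder.zero_mem n
  isHermitian _ _ hv := hv.1
  add_mem _ _ hv _ hw := hX.karnCones_add_mem hv hw
  compress_mem _ _ γ _ hw := hX.karnCones_compress_mem γ hw

open scoped Matrix.Norms.L2Operator in
/-- Over a vanishing scalar part, Karn's cone reduces to the cone of `X`. -/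
lemma fst_mem_of_mem_karnCones (hX : IsLInftyMatricialRieszNormed C N) {n : ℕ}
    {w : Matrix (Fin n) (Fin n) (X × ℂ)} (hw : w ∈ karnCones C N n)
    (h0 : w.map Prod.snd = 0) : w.map Prod.fst ∈ C n := by
  refine hX.closed n _ fun ε hε => ?_
  obtain ⟨u, hu, hu1, h⟩ := hw.2.2 (ε / 2) (half_pos hε)
  refine ⟨_, h, ?_⟩
  set S := shiftedSqrt (w.map Prod.snd) (ε / 2) with hS
  have hSS : S * S = ((ε / 2 : ℝ) : ℂ) • 1 := by
    rw [hS, shiftedSqrt_mul_self hw.2.1 (half_pos hε), h0, zero_add]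
  have hnorm : ‖S‖ * ‖S‖ ≤ ε / 2 := by
    -- Only an inequality, since the identity has norm `0` when `n = 0`.
    have h1 : ‖(1 : Matrix (Fin n) (Fin n) ℂ)‖ ≤ 1 :=
      norm_le_one_of_posSemidef (by simpa using Matrix.PosSemidef.zero)
    rw [← Matrix.l2_opNorm_conjTranspose_mul_self, hS, shiftedSqrt_conjTranspose, ← hS, hSS,
      norm_smul, Complex.norm_of_nonneg (half_pos hε).le]
    exact mul_le_of_le_one_right (half_pos hε).le h1
  have hle := hX.matrixNorm.sandwich_le n n S u S
  have hNu := hX.matrixNorm.nonneg u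
  rw [sub_add_cancel_left, hX.matrixNorm.map_neg]
  calc N n (scalarSandwich S u S) ≤ ‖S‖ * ‖S‖ * N n u := by linarith
    _ ≤ ε / 2 * 1 := by gcongr
    _ < ε := by linarith

/-- The scalar part vanishes because it is positive and negative semidefinite; then both signs of
the `X`-part lie in the proper cone `C n`. -/
lemma karnCones_proper (hX : IsLInftyMatricialRieszNormed C N) {n : ℕ}
    {w : Matrix (Fin n) (Fin n) (X × ℂ)} (hw : w ∈ karnCones C N n)
    (hw' : -w ∈ karnCones C N n) : w = 0 := by
  have e₁ : (-w).map Prod.fst = -w.map Prod.fst := rfl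
  have e₂ : (-w).map Prod.snd = -w.map Prod.snd := rfl
  have h0 : w.map Prod.snd = 0 := by
    open scoped MatrixOrder in
    exact le_antisymm (Matrix.le_iff.2 (by simpa [e₂] using hw'.2.1)) hw.2.1.nonneg
  have h1 := hX.fst_mem_of_mem_karnCones hw h0
  have h2 := hX.fst_mem_of_mem_karnCones hw' (by rw [e₂, h0, neg_zero])
  have h3 := hX.eq_zero_of_mem_of_neg_mem h1 (e₁ ▸ h2)
  ext i j
  · exact congrFun (congrFun h3 i) j
  · exact congrFun (congrFun h0 i) j

lemma karnCones_orderUnit (hX : IsLInftyMatricialRieszNormed C N) {n : ℕ}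
    {w : Matrix (Fin n) (Fin n) (X × ℂ)} (hw : w.IsHermitian) :
    ∃ t > 0, unitMatrix ((0, 1) : X × ℂ) n t + w ∈ karnCones C N n := by
  obtain ⟨s, hs, hA⟩ := exists_posSemidef_smul_one_add hw.map_snd
  obtain ⟨u, hu, h, -⟩ := hX.exists_dominating (-w.map Prod.fst) (lt_add_one _)
  have hv : (w.map Prod.fst)ᴴ = w.map Prod.fst := hw.map_fst
  have hNu := hX.matrixNorm.nonneg u
  have hr : 0 < N n u + 1 := by linarith
  have hsq : star (Real.sqrt (N n u + 1) : ℂ) * (Real.sqrt (N n u + 1) : ℂ) =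
      ((N n u + 1 : ℝ) : ℂ) := by
    rw [Complex.star_def, Complex.conj_ofReal, ← Complex.ofReal_mul, Real.mul_self_sqrt hr.le]
  have hsplit : (((N n u + 1) + s : ℝ) : ℂ) • (1 : Matrix (Fin n) (Fin n) ℂ) + w.map Prod.snd =
      ((N n u + 1 : ℝ) : ℂ) • 1 + ((s : ℂ) • 1 + w.map Prod.snd) := by
    rw [Complex.ofReal_add _ s, add_smul, add_assoc]
  -- The summand `s` makes the scalar part positive; `‖u‖ + 1` pays for `u ≥ -v`, rescaled to norm
  -- below `1`.
  refine ⟨(N n u + 1) + s, by linarith, hX.mem_karnCones_iff.2 ?_⟩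
  rw [map_fst_unitMatrix_add, map_snd_unitMatrix_add, hsplit]
  refine ⟨(isHermitian_unitMatrix _).add hw, (posSemidef_smul_one hr.le).add hA, fun ε hε =>
    ⟨n, (Real.sqrt (N n u + 1) : ℂ) • 1, (((N n u + 1)⁻¹ : ℝ) : ℂ) • u,
      hX.matrixOrder.smul_mem (inv_pos.2 hr).le hu, ?_, ?_, ?_⟩⟩
  · rw [hX.matrixNorm.smul_real (inv_pos.2 hr).le, inv_mul_eq_div, div_lt_one hr]
    exact lt_add_one _
  · rw [Matrix.conjTranspose_smul, Matrix.conjTranspose_one, Matrix.smul_mul, Matrix.mul_smul,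
      Matrix.one_mul, smul_smul, hsq]
    convert hA.add (posSemidef_smul_one hε.le) using 1
    abel
  · rw [Matrix.conjTranspose_smul, Matrix.conjTranspose_one, scalarSandwich_smul_one, hsq,
      smul_smul, ← Complex.ofReal_mul, mul_inv_cancel₀ hr.ne', Complex.ofReal_one, one_smul]
    convert hX.matrixOrder.smul_mem (show (0 : ℝ) ≤ 2⁻¹ by norm_num) h using 1
    rw [Matrix.conjTranspose_neg, hv, ← neg_add, sub_neg_eq_add, ← two_smul ℂ, ← smul_add,
      smul_smul]
    norm_num [add_comm]

lemma karnCones_archimedean (hX : IsLInftyMatricialRieszNormed C N) {n : ℕ}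
    {w : Matrix (Fin n) (Fin n) (X × ℂ)}
    (h : ∀ t > 0, unitMatrix ((0, 1) : X × ℂ) n t + w ∈ karnCones C N n) :
    w ∈ karnCones C N n := by
  refine hX.mem_karnCones_iff.2 ⟨?_, ?_, fun ε hε => ?_⟩
  · simpa using (h 1 one_pos).1.sub (isHermitian_unitMatrix 1)
  · refine posSemidef_of_forall_add_smul_one fun ε hε => ?_
    have h1 := (h ε hε).2.1
    rwa [map_snd_unitMatrix_add, add_comm] at h1
  -- Half of `ε` goes to the order unit and half to Karn's condition.
  · obtain ⟨m, β, u, hu, hu1, hβ, hmem⟩ :=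
      (hX.mem_karnCones_iff.1 (h (ε / 2) (half_pos hε))).2.2 (ε / 2) (half_pos hε)
    rw [map_fst_unitMatrix_add] at hmem
    refine ⟨m, β, u, hu, hu1, ?_, hmem⟩
    rw [map_snd_unitMatrix_add] at hβ
    convert hβ using 2
    rw [add_comm (_ • _) (w.map _), add_assoc, ← add_smul, ← Complex.ofReal_add, add_halves]

lemma karnCones_isOperatorSystem [StarModule ℂ X] (hX : IsLInftyMatricialRieszNormed C N) :
    IsOperatorSystem (karnCones C N) ((0, 1) : X × ℂ) where
  matrixOrder := hX.karnCones_isMatrixOrder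
  proper _ _ hv hv' := hX.karnCones_proper hv hv'
  orderUnit _ _ hv := hX.karnCones_orderUnit hv
  archimedean _ _ h := hX.karnCones_archimedean h

/-! ### Equality of the two families of cones. -/

lemma karnCones_subset_wernerCones (hX : IsLInftyMatricialRieszNormed C N) (n : ℕ) :
    karnCones C N n ⊆ wernerCones C N n := by
  rintro w ⟨hw, hA, H⟩
  refine ⟨hw, hA, fun ε hε φ hφ => ?_⟩
  obtain ⟨u, hu, hu1, h⟩ := H ε hε
  set S := shiftedSqrt (w.map Prod.snd) ε
  have hdet : IsUnit S.det := isUnit_det_shiftedSqrt hA hε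
  have h' := hX.matrixOrder.compress_mem _ _ S⁻¹ _ h
  rw [inv_shiftedSqrt_conjTranspose, scalarSandwich_add, scalarSandwich_scalarSandwich,
    Matrix.nonsing_inv_mul _ hdet, Matrix.mul_nonsing_inv _ hdet, scalarSandwich_one] at h'
  have h1 := (Complex.le_def.1 (hφ.1 _ h')).1
  rw [map_add, Complex.zero_re, Complex.add_re] at h1
  have h2 := (Complex.re_le_norm (φ u)).trans (hφ.2 u)
  linarith

lemma wernerCones_subset_karnCones [StarModule ℂ X] (hX : IsLInftyMatricialRieszNormed C N)
    (n : ℕ) : wernerCones C N n ⊆ karnCones C N n := by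
  rintro w ⟨hw, hA, H⟩
  refine hX.mem_karnCones_iff.2 ⟨hw, hA, fun ε hε => ?_⟩
  obtain ⟨s, hs, hsA⟩ := exists_posSemidef_smul_one_add hA.isHermitian.neg
  set A := w.map Prod.snd
  set v := w.map Prod.fst
  have hv : vᴴ = v := hw.map_fst
  have hε' : 0 < ε / 4 := by linarith
  -- With `A ≤ s`, this choice gives `(1 + δ)(A + ε/4) ≤ A + δ s + ε/2 ≤ A + ε`.
  obtain ⟨δ, hδ, hδ1, hδs⟩ : ∃ δ : ℝ, 0 < δ ∧ δ ≤ 1 ∧ δ * s ≤ ε / 2 := by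
    refine ⟨ε / (2 * s + ε), by positivity, ?_, ?_⟩
    · rw [div_le_one (by positivity)]; linarith
    · rw [div_mul_eq_mul_div, div_le_div_iff₀ (by positivity) two_pos]
      nlinarith [mul_pos hε hε]
  set S := shiftedSqrt A (ε / 4)
  have hdet : IsUnit S.det := isUnit_det_shiftedSqrt hA hε'
  have hSh : Sᴴ = S := shiftedSqrt_conjTranspose A _
  set x := scalarSandwich S⁻¹ v S⁻¹ with hx
  have hxs : xᴴ = x := by
    rw [hx, scalarSandwich_conjTranspose, hv, inv_shiftedSqrt_conjTranspose]
  have hSx : scalarSandwich S x S = v := by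
    rw [hx, scalarSandwich_scalarSandwich, Matrix.nonsing_inv_mul _ hdet,
      Matrix.mul_nonsing_inv _ hdet, scalarSandwich_one]
  obtain ⟨φ, hφ, hφx⟩ := hX.exists_functional_eq_dominatingGauge (-x)
  -- Werner's condition at the functional attaining the gauge bounds it by `1`; the margin `δ` is
  -- needed because the infimum need not be attained.
  have hg : hX.dominatingGauge (-x) < 1 + δ := by
    have h1 := H (ε / 4) hε' φ hφ
    rw [← hφx, map_neg, Complex.neg_re]
    linarith
  obtain ⟨u, hu, h, hu1⟩ := hX.exists_of_dominatingGauge_lt _ hg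
  have hd : 0 < 1 + δ := by linarith
  have hsq : star (Real.sqrt (1 + δ) : ℂ) * (Real.sqrt (1 + δ) : ℂ) = ((1 + δ : ℝ) : ℂ) := by
    rw [Complex.star_def, Complex.conj_ofReal, ← Complex.ofReal_mul, Real.mul_self_sqrt hd.le]
  have hxu : x + u ∈ C n := by
    convert hX.matrixOrder.smul_mem (show (0 : ℝ) ≤ 2⁻¹ by norm_num) h using 1
    rw [Matrix.conjTranspose_neg, hxs, ← neg_add, sub_neg_eq_add, ← two_smul ℂ, ← smul_add,
      smul_smul]
    norm_num [add_comm]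
  -- The factor `1 + δ` moves from `u` into `β`, making the norm of `u` less than `1`.
  refine ⟨n, ((Real.sqrt (1 + δ) : ℂ) • 1) * S, (((1 + δ)⁻¹ : ℝ) : ℂ) • u,
    hX.matrixOrder.smul_mem (inv_pos.2 hd).le hu, ?_, ?_, ?_⟩
  · rw [hX.matrixNorm.smul_real (inv_pos.2 hd).le, inv_mul_eq_div, div_lt_one hd]
    exact hu1
  · have hc : 0 ≤ ε - (1 + δ) * (ε / 4) - δ * s := by nlinarith
    convert (hsA.smul (show (0 : ℂ) ≤ (δ : ℂ) by exact_mod_cast hδ.le)).add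
      (posSemidef_smul_one hc) using 1
    rw [Matrix.smul_mul, Matrix.one_mul, Matrix.conjTranspose_smul, hSh, Matrix.smul_mul,
      Matrix.mul_smul, smul_smul, hsq, shiftedSqrt_mul_self hA hε']
    push_cast
    module
  · rw [Matrix.conjTranspose_mul, hSh, ← scalarSandwich_scalarSandwich, Matrix.conjTranspose_smul,
      Matrix.conjTranspose_one, scalarSandwich_smul_one, hsq, smul_smul, ← Complex.ofReal_mul,
      mul_inv_cancel₀ hd.ne', Complex.ofReal_one, one_smul]
    have h2 := hX.matrixOrder.compress_mem _ _ S _ hxu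
    rwa [scalarSandwich_add, hSh, hSx] at h2

lemma wernerCones_eq_karnCones [StarModule ℂ X] (hX : IsLInftyMatricialRieszNormed C N) :
    wernerCones C N = karnCones C N :=
  funext fun n => Set.Subset.antisymm (hX.wernerCones_subset_karnCones n)
    (hX.karnCones_subset_wernerCones n)

end IsLInftyMatricialRieszNormed

end Unitization

theorem proposition3p3 {X : Type*} [AddCommGroup X] [Module ℂ X] [StarAddMonoid X]
    [StarModule ℂ X] (C : MatrixCones X) (N : MatrixNorms X)
    (hX : IsLInftyMatricialRieszNormed C N) :
    IsOperatorSystem (wernerCones C N) ((0, 1) : X × ℂ) ∧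
    IsOperatorSystem (karnCones C N) ((0, 1) : X × ℂ) ∧
    IsCompleteOrderIso (wernerCones C N) (karnCones C N) (LinearEquiv.refl ℂ (X × ℂ)) ∧
    IsCompleteIsometry (operatorSystemNorm (wernerCones C N) ((0, 1) : X × ℂ))
      (operatorSystemNorm (karnCones C N) ((0, 1) : X × ℂ)) (LinearEquiv.refl ℂ (X × ℂ)) := by
  rw [hX.wernerCones_eq_karnCones]
  exact ⟨hX.karnCones_isOperatorSystem, hX.karnCones_isOperatorSystem, fun _ _ => Iff.rfl,
    fun _ _ => rfl⟩
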